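/- Let $p$ be an odd prime and let $K=\mathbb{Q}_p(\omega)$ be the unramified quadratic extension of $\mathbb{Q}_p$, where $\omega$ is a root of a monic quadratic polynomial over $\mathbb{Z}_p$ whose reduction modulo $p$ is irreducible over $\mathbb{F}_p$; $K$ carries the absolute value extending the $p$-adic one. Let $G=\operatorname{PGL}_2(K)$, with the quotient topology from $\operatorname{GL}_2(K)$ and identity $e$, and let $H=\operatorname{PGL}_2(\mathbb{Q}_p)\subset G$. For $s\in K$ write $u_s=\begin{pmatrix}1&s\\0&1\end{pmatrix}$, and let $$\mathcal{A}=\{\operatorname{diag}(a,1):a\in\mathbb{Q}_p^\times\},\quad \mathcal{U}=\{u_t:t\in\mathbb{Q}_p\},\quad \mathcal{V}=\{u_{\omega t}:t\in\mathbb{Q}_p\},\quad \mathcal{N}=\{u_s:s\in K\}.$$ For $k\in\mathbb{N}$, a set $T\subset\mathbb{Q}_p$ is called $k$-thick if $(p^{-(k+l)}\mathbb{Z}_p\setminus p^{-l}\mathbb{Z}_p)\cap T\neq\emptyset$ for every $l\in\mathbb{Z}$. **Theorem.** Suppose that $g_n\to e$ with $g_n\in G\setminus\mathcal{V}H$ for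 all $n$, and that $g_n'\to e$ with $g_n'\in G\setminus\mathcal{A}\mathcal{N}$ for all $n$. Let $k\in\mathbb{N}$, let $T_n\subset\mathbb{Q}_p$ $(n\in\mathbb{N})$ be $k$-thick sets and let $G_0$ be a neighbourhood of $e$ in $G$. 1. There are $t_n\in T_n$ and $h_n\in H$ such that, after passing to a subsequence, $u_{t_n}g_nh_n\to g$ for some $g\in(\mathcal{V}\setminus\{e\})\cap G_0$. 2. There are $t_n\in T_n$ and $s_n\in\mathbb{Q}_p$ with $u_{t_n}\to\infty$ and $u_{s_n}\to\infty$ in $\mathcal{U}$ such that, after passing to a subsequence, $u_{t_n}g_n'u_{s_n}\to g$ for some $g\in(\mathcal{A}\mathcal{V}\setminus\{e\})\cap G_0$. In particular, since $\mathbb{Q}_p$ is $1$-thick, both assertions hold with no restriction on the $t_n\in\mathbb{Q}_p$. -/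

import Mathlib

open Filter Topology Polynomial
open scoped MatrixGroups Pointwise

noncomputable section

/-- `K` is the unramified quadratic extension `ℚ_p(ω)` of `ℚ_p`, where `ω` is a root of a monic
quadratic polynomial over `ℤ_p` whose reduction modulo `p` is irreducible over `𝔽_p`.  The absolute
value of the normed field `K` is then the unique one that extends the `p`-adic absolute value. -/
structure IsUnramifiedQuadratic (p : ℕ) [Fact p.Prime] (K : Type*) [NormedField K]
    [NormedAlgebra ℚ_[p] K] (ω : K) : Prop where
  finrank_eq_two : Module.finrank ℚ_[p] K = 2
  exists_poly : ∃ f : ℤ_[p][X], f.Monic ∧ f.natDegree = 2 ∧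
    Irreducible (f.map (PadicInt.toZMod : ℤ_[p] →+* ZMod p)) ∧
    f.eval₂ ((algebraMap ℚ_[p] K).comp (PadicInt.Coe.ringHom : ℤ_[p] →+* ℚ_[p])) ω = 0

/-- The topology of `PGL(2, K)` is the quotient topology from `GL(2, K)`. -/
instance instTopologicalSpacePGL (K : Type*) [NormedField K] : TopologicalSpace PGL(2, K) :=
  TopologicalSpace.coinduced (Matrix.ProjGenLinGroup.mk : GL (Fin 2) K → PGL(2, K)) inferInstance

/-- The class `u_s` of the matrix with rows `(1, s)` and `(0, 1)`. -/
def unip {K : Type*} [Field K] (s : K) : PGL(2, K) :=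
  Matrix.ProjGenLinGroup.mk
    (Matrix.GeneralLinearGroup.mkOfDetNeZero !![1, s; 0, 1] (by simp [Matrix.det_fin_two]))

/-- The class of the diagonal matrix `diag(a, 1)`. -/
def diagOne {K : Type*} [Field K] (a : Kˣ) : PGL(2, K) :=
  Matrix.ProjGenLinGroup.mk
    (Matrix.GeneralLinearGroup.mkOfDetNeZero !![(a : K), 0; 0, 1] (by simp [Matrix.det_fin_two]))

/-- `H = PGL(2, ℚ_p)` as a subgroup of `PGL(2, K)`. -/
def subgroupH (p : ℕ) [Fact p.Prime] (K : Type*) [NormedField K] [NormedAlgebra ℚ_[p] K] :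
    Subgroup PGL(2, K) :=
  (Matrix.ProjGenLinGroup.map (n := Fin 2) (algebraMap ℚ_[p] K)).range

/-- `𝒜 = {diag(a, 1) : a ∈ ℚ_pˣ}`. -/
def setA (p : ℕ) [Fact p.Prime] (K : Type*) [NormedField K] [NormedAlgebra ℚ_[p] K] :
    Set PGL(2, K) :=
  Set.range fun a : ℚ_[p]ˣ => diagOne (Units.map (algebraMap ℚ_[p] K : ℚ_[p] →* K) a)

/-- `𝒩 = {u_s : s ∈ K}`. -/
def setN (K : Type*) [Field K] : Set PGL(2, K) :=
  Set.range fun s : K => unip s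

/-- `𝒱 = {u_{ω t} : t ∈ ℚ_p}`. -/
def setV (p : ℕ) [Fact p.Prime] {K : Type*} [NormedField K] [NormedAlgebra ℚ_[p] K] (ω : K) :
    Set PGL(2, K) :=
  Set.range fun t : ℚ_[p] => unip (ω * algebraMap ℚ_[p] K t)

/-- The fractional ideal `p ^ m ℤ_p` of `ℚ_p`. -/
def padicIdeal (p : ℕ) [Fact p.Prime] (m : ℤ) : Set ℚ_[p] :=
  Set.range fun z : ℤ_[p] => (p : ℚ_[p]) ^ m * (z : ℚ_[p])

/-- `T ⊆ ℚ_p` is `k`-thick: it meets `p ^ (-(k + l)) ℤ_p \ p ^ (-l) ℤ_p` for every integer `l`. -/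
def IsThick (p : ℕ) [Fact p.Prime] (k : ℕ) (T : Set ℚ_[p]) : Prop :=
  ∀ l : ℤ, ((padicIdeal p (-((k : ℤ) + l)) \ padicIdeal p (-l)) ∩ T).Nonempty

end

/-!
Both assertions come down to a polynomial in `t` with `ℚ_p`-coefficients tending to `0`, evaluated
at a point of a thick set.

For the first one, write a matrix representing `g n` as `X + ω Y` with `X`, `Y` over `ℚ_p`. Modulo
`H` on the right it becomes `1 + ω Z` with `Z = Y X⁻¹ → 0` (`exists_onePlus_of_tendsto`).
Conjugation by `u_t` turns `Z` into a matrix whose upper right entry is the polynomial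
`Z₀₁ + (Z₁₁ - Z₀₀) t - Z₁₀ t ^ 2`, and this polynomial is nonconstant because `g n` does not lie in
`𝒱 H` (`projMk_onePlus_mem`). If `t` is such that the nonconstant part of the polynomial has norm
between `η` and `δ`, and both of its monomials are bounded by `δ`, then the three other entries
still tend to `0`, and a subsequence converges to `u_{ω v}` with `η ≤ ‖v‖ ≤ δ`.

For the second one, normalize the matrix of `g' n` to have lower right entry `1` and write its
other entries as `a = a₀ + ω a₁`, `b = b₀ + ω b₁`, `c = c₀ + ω c₁`. For given `t`, the choice
`s = -(b₀ + t) / (a₀ + t c₀)` removes the `ℚ_p`-part of the upper right entry of `u_t g u_s`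
(`unip_mul_projMk_mul_unip`). If `c₀ t → κ` and `a₁ t + c₁ t ^ 2 → w`, then `c₁ t → 0` and the limit
is `diag((1 + κ) ^ 2, 1) u_{ω v}` with `v = -w / (1 + κ) ^ 2`, which is nontrivial for small
`(κ, w) ≠ 0`. Not lying in `𝒜 𝒩` means that `a₁`, `c₁`, `c₀` are not all zero.

The point `t` of the thick set is provided in both cases by `exists_lower_bound_of_isThick`. It
rests on the fact that `e t` and `c t ^ 2` have the same norm for one value of `‖t‖` at most, so
that cancellation is avoided at one of two points of different norms.
-/

/-! ### The class of a matrix in `PGL(2, K)` -/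

/-- The class in `PGL(2, K)` of a matrix of nonzero determinant; singular matrices are sent to `1`,
so that sequences of matrices can be projected without carrying along proofs of invertibility. -/
noncomputable def projMk {K : Type*} [Field K] (A : Matrix (Fin 2) (Fin 2) K) : PGL(2, K) :=
  open scoped Classical in
  if h : A.det ≠ 0 then
    Matrix.ProjGenLinGroup.mk (Matrix.GeneralLinearGroup.mkOfDetNeZero A h)
  else 1

section Algebra

variable {K : Type*} [Field K]

lemma projMk_of_det_ne_zero {A : Matrix (Fin 2) (Fin 2) K} (h : A.det ≠ 0) :
    projMk A = Matrix.ProjGenLinGroup.mk (Matrix.GeneralLinearGroup.mkOfDetNeZero A h) := by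
  simp [projMk, h]

lemma projMk_coe (g : GL (Fin 2) K) :
    projMk (g : Matrix (Fin 2) (Fin 2) K) = Matrix.ProjGenLinGroup.mk g := by
  rw [projMk_of_det_ne_zero g.det_ne_zero]
  congr 1
  ext i j
  rfl

lemma projMk_mul {A B : Matrix (Fin 2) (Fin 2) K} (hA : A.det ≠ 0) (hB : B.det ≠ 0) :
    projMk (A * B) = projMk A * projMk B := by
  have hAB : (A * B).det ≠ 0 := by
    rw [Matrix.det_mul]
    exact mul_ne_zero hA hB
  rw [projMk_of_det_ne_zero hA, projMk_of_det_ne_zero hB, projMk_of_det_ne_zero hAB, ← map_mul]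
  congr 1
  ext i j
  rfl

lemma projMk_one : projMk (1 : Matrix (Fin 2) (Fin 2) K) = 1 := by
  simpa using projMk_coe (1 : GL (Fin 2) K)

lemma projMk_smul {c : K} (hc : c ≠ 0) {A : Matrix (Fin 2) (Fin 2) K} (hA : A.det ≠ 0) :
    projMk (c • A) = projMk A := by
  have hcA : (c • A).det ≠ 0 := by
    rw [Matrix.det_smul]
    exact mul_ne_zero (pow_ne_zero _ hc) hA
  rw [projMk_of_det_ne_zero hA, projMk_of_det_ne_zero hcA, eq_comm,
    Matrix.ProjGenLinGroup.mk_eq_mk_iff]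
  refine ⟨Units.mk0 c hc, ?_⟩
  ext i j
  change (A * Matrix.scalar (Fin 2) c) i j = (c • A) i j
  simp [mul_comm]

/-- A matrix whose class is trivial is scalar. -/
lemma entries_of_projMk_eq_one {A : Matrix (Fin 2) (Fin 2) K} (hA : A.det ≠ 0)
    (h : projMk A = 1) : A 0 1 = 0 ∧ A 0 0 = A 1 1 := by
  rw [projMk_of_det_ne_zero hA, ← Matrix.ProjGenLinGroup.mk_one, eq_comm,
    Matrix.ProjGenLinGroup.mk_eq_mk_iff] at h
  obtain ⟨u, hu⟩ := h
  have h' : Matrix.scalar (Fin 2) (u : K) = A := by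
    have := congrArg (fun g : GL (Fin 2) K => (g : Matrix (Fin 2) (Fin 2) K)) hu
    simp only [one_mul] at this
    exact this
  rw [← h']
  simp

lemma unip_eq_projMk (s : K) : unip s = projMk !![1, s; 0, 1] :=
  (projMk_of_det_ne_zero (by simp [Matrix.det_fin_two])).symm

lemma diagOne_eq_projMk (a : Kˣ) : diagOne a = projMk !![(a : K), 0; 0, 1] :=
  (projMk_of_det_ne_zero (by simp [Matrix.det_fin_two])).symm

lemma unip_add (s t : K) : unip (s + t) = unip s * unip t := by
  rw [unip_eq_projMk, unip_eq_projMk, unip_eq_projMk, ← projMk_mul (by simp) (by simp)]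
  congr 1
  ext i j
  fin_cases i <;> fin_cases j <;> simp [add_comm]

lemma unip_zero : unip (0 : K) = 1 := by
  rw [unip_eq_projMk, ← projMk_one, Matrix.one_fin_two]

lemma unip_ne_one {s : K} (hs : s ≠ 0) : unip s ≠ 1 := by
  intro h
  rw [unip_eq_projMk] at h
  exact hs (by simpa using (entries_of_projMk_eq_one (by simp) h).1)

lemma diagOne_mul_unip (a : Kˣ) (s : K) :
    diagOne a * unip s = projMk !![(a : K), a * s; 0, 1] := by
  rw [unip_eq_projMk, diagOne_eq_projMk, ← projMk_mul (by simp) (by simp)]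
  congr 1
  ext i j
  fin_cases i <;> fin_cases j <;> simp

end Algebra

/-! ### Topology of `PGL(2, K)` -/

section Topology

variable {K : Type*} [NormedField K]

lemma isOpenMap_mk :
    IsOpenMap (Matrix.ProjGenLinGroup.mk : GL (Fin 2) K → PGL(2, K)) :=
  QuotientGroup.isOpenMap_coe (N := Subgroup.center (GL (Fin 2) K))

lemma continuous_mk :
    Continuous (Matrix.ProjGenLinGroup.mk : GL (Fin 2) K → PGL(2, K)) :=
  continuous_coinduced_rng

lemma continuousAt_projMk {A : Matrix (Fin 2) (Fin 2) K} (hA : A.det ≠ 0) :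
    ContinuousAt projMk A := by
  have hopen : IsOpen {B : Matrix (Fin 2) (Fin 2) K | B.det ≠ 0} :=
    isOpen_ne.preimage (continuous_id.matrix_det)
  refine ContinuousOn.continuousAt (s := {B | B.det ≠ 0}) ?_ (hopen.mem_nhds hA)
  rw [continuousOn_iff_continuous_domRestrict]
  have heq : Set.domRestrict {B : Matrix (Fin 2) (Fin 2) K | B.det ≠ 0} projMk =
      fun B => Matrix.ProjGenLinGroup.mk
        (Matrix.GeneralLinearGroup.mkOfDetNeZero B.1 B.2) := by
    funext B
    exact projMk_of_det_ne_zero B.2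
  rw [heq]
  refine continuous_mk.comp (Units.continuous_iff.2 ⟨continuous_subtype_val, ?_⟩)
  have hinv : (fun B : {B : Matrix (Fin 2) (Fin 2) K | B.det ≠ 0} =>
      (((Matrix.GeneralLinearGroup.mkOfDetNeZero B.1 B.2)⁻¹ : GL (Fin 2) K) :
        Matrix (Fin 2) (Fin 2) K)) = fun B => (B.1.det)⁻¹ • B.1.adjugate := by
    funext B
    rw [Matrix.coe_units_inv, Matrix.inv_def, Ring.inverse_eq_inv']
    rfl
  refine hinv ▸ ?_
  exact ((continuous_subtype_val.matrix_det).inv₀ fun B => B.2).smul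
    continuous_subtype_val.matrix_adjugate

/-- Sequences converging to `1` in `PGL(2, K)` lift to matrices converging to `1`; the lift is
normalized by dividing a representative by its lower right entry. -/
lemma exists_tendsto_projMk_eq {g : ℕ → PGL(2, K)} (hg : Tendsto g atTop (𝓝 1)) :
    ∃ A : ℕ → Matrix (Fin 2) (Fin 2) K, Tendsto A atTop (𝓝 1) ∧
      ∀ᶠ n in atTop, (A n).det ≠ 0 ∧ g n = projMk (A n) ∧ A n 1 1 = 1 := by
  have hsurj : Function.Surjective (Matrix.ProjGenLinGroup.mk : GL (Fin 2) K → PGL(2, K)) :=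
    Matrix.ProjGenLinGroup.mk_surjective
  let r : PGL(2, K) → Matrix (Fin 2) (Fin 2) K := fun x => (Function.surjInv hsurj x : GL (Fin 2) K)
  have hdet (x) : (r x).det ≠ 0 := Matrix.GeneralLinearGroup.det_ne_zero _
  have hr (x) : projMk (r x) = x :=
    (projMk_coe _).trans (Function.surjInv_eq hsurj x)
  let N : PGL(2, K) → Matrix (Fin 2) (Fin 2) K := fun x => (r x 1 1)⁻¹ • r x
  have hN (A : GL (Fin 2) K) : N (Matrix.ProjGenLinGroup.mk A) =
      ((A : Matrix (Fin 2) (Fin 2) K) 1 1)⁻¹ • (A : Matrix (Fin 2) (Fin 2) K) := by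
    obtain ⟨u, hu⟩ := Matrix.ProjGenLinGroup.mk_eq_mk_iff.1
      (Function.surjInv_eq hsurj (Matrix.ProjGenLinGroup.mk A)).symm
    have hu' : r (Matrix.ProjGenLinGroup.mk A) =
        (u : K) • (A : Matrix (Fin 2) (Fin 2) K) := by
      have h2 : (A : Matrix (Fin 2) (Fin 2) K) * Matrix.scalar (Fin 2) (u : K) =
        r (Matrix.ProjGenLinGroup.mk A) :=
        congrArg (fun g : GL (Fin 2) K => (g : Matrix (Fin 2) (Fin 2) K)) hu
      rw [← h2]
      ext i j
      simp [mul_comm]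
    simp only [N, hu', Matrix.smul_apply, smul_eq_mul, smul_smul]
    congr 1
    rw [mul_inv, mul_right_comm, inv_mul_cancel₀ u.ne_zero, one_mul]
  have hmap : map Matrix.ProjGenLinGroup.mk (𝓝 (1 : GL (Fin 2) K)) = 𝓝 (1 : PGL(2, K)) :=
    isOpenMap_mk.map_nhds_eq continuous_mk.continuousAt
  have hval : Continuous fun A : GL (Fin 2) K => (A : Matrix (Fin 2) (Fin 2) K) :=
    Units.continuous_val
  have hNt : Tendsto N (𝓝 1) (𝓝 1) := by
    rw [← hmap, tendsto_map'_iff]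
    have : N ∘ Matrix.ProjGenLinGroup.mk = fun A : GL (Fin 2) K =>
      ((A : Matrix (Fin 2) (Fin 2) K) 1 1)⁻¹ • (A : Matrix (Fin 2) (Fin 2) K) := _root_.funext hN
    rw [this]
    have hc : ContinuousAt (fun A : GL (Fin 2) K =>
        ((A : Matrix (Fin 2) (Fin 2) K) 1 1)⁻¹ • (A : Matrix (Fin 2) (Fin 2) K)) 1 :=
      ((hval.matrix_elem 1 1).continuousAt.inv₀ (by simp)).smul hval.continuousAt
    simpa [ContinuousAt] using hc
  refine ⟨fun n => N (g n), hNt.comp hg, ?_⟩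
  have hne : ∀ᶠ B : Matrix (Fin 2) (Fin 2) K in 𝓝 1, B 1 1 ≠ 0 :=
    (continuous_id.matrix_elem 1 1).continuousAt.eventually_ne (by simp)
  filter_upwards [(hNt.comp hg).eventually hne] with n hn
  have h0 : r (g n) 1 1 ≠ 0 := fun h => hn (by simp [N, h])
  refine ⟨?_, ?_, ?_⟩
  · rw [Matrix.det_smul]
    exact mul_ne_zero (pow_ne_zero _ (inv_ne_zero h0)) (hdet _)
  · rw [projMk_smul (inv_ne_zero h0) (hdet _), hr]
  · simp [N, h0]

lemma continuous_unip : Continuous (unip : K → PGL(2, K)) := by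
  refine continuous_iff_continuousAt.2 fun s => ?_
  rw [_root_.funext unip_eq_projMk]
  refine ContinuousAt.comp (f := fun s : K => !![1, s; 0, 1]) (continuousAt_projMk (by simp)) ?_
  refine (continuous_matrix fun i j => ?_).continuousAt
  fin_cases i <;> fin_cases j <;> simp [continuous_const, continuous_id']

lemma tendsto_matrix_fin_two {ι : Type*} {l : Filter ι} {a b c d : ι → K} {a' b' c' d' : K}
    (ha : Tendsto a l (𝓝 a')) (hb : Tendsto b l (𝓝 b')) (hc : Tendsto c l (𝓝 c'))
    (hd : Tendsto d l (𝓝 d')) :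
    Tendsto (fun n => !![a n, b n; c n, d n]) l (𝓝 !![a', b'; c', d']) := by
  refine tendsto_pi_nhds.2 fun i => tendsto_pi_nhds.2 fun j => ?_
  fin_cases i <;> fin_cases j <;> simpa

end Topology

/-! ### Elements of `H` -/

lemma projMk_map_mem_subgroupH {p : ℕ} [Fact p.Prime] (K : Type*) [NormedField K]
    [NormedAlgebra ℚ_[p] K] {B : Matrix (Fin 2) (Fin 2) ℚ_[p]} (hB : B.det ≠ 0) :
    projMk (B.map (algebraMap ℚ_[p] K)) ∈ subgroupH p K := by
  refine ⟨projMk B, ?_⟩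
  rw [projMk_of_det_ne_zero hB, Matrix.ProjGenLinGroup.map_mk, ← projMk_coe]
  rfl

lemma unip_algebraMap_mem_subgroupH {p : ℕ} [Fact p.Prime] (K : Type*) [NormedField K]
    [NormedAlgebra ℚ_[p] K] (t : ℚ_[p]) : unip (algebraMap ℚ_[p] K t) ∈ subgroupH p K := by
  have h := projMk_map_mem_subgroupH K (B := !![1, t; 0, 1]) (by simp)
  rw [unip_eq_projMk]
  convert h using 2
  ext i j
  fin_cases i <;> fin_cases j <;> simp

/-! ### Coordinates with respect to `1, ω` -/

section Coordinates

variable {p : ℕ} [Fact p.Prime] {K : Type*} [NormedField K] [NormedAlgebra ℚ_[p] K] {ω : K}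

/-- `ω` does not lie in `ℚ_p`: it would be integral, and its reduction would be a root of an
irreducible quadratic polynomial over `𝔽_p`. -/
lemma IsUnramifiedQuadratic.algebraMap_ne (hK : IsUnramifiedQuadratic p K ω) (x : ℚ_[p]) :
    algebraMap ℚ_[p] K x ≠ ω := by
  rintro rfl
  obtain ⟨f, hmonic, hdeg, hirr, hroot⟩ := hK.exists_poly
  rw [← Polynomial.hom_eval₂, map_eq_zero] at hroot
  have hint : IsIntegral ℤ_[p] x := ⟨f, hmonic, hroot⟩
  obtain ⟨z, rfl⟩ := IsIntegrallyClosed.isIntegral_iff.1 hint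
  have hz : f.eval z = 0 := by
    have h1 : f.eval₂ (PadicInt.Coe.ringHom : ℤ_[p] →+* ℚ_[p]) (PadicInt.Coe.ringHom z) = 0 := hroot
    rw [Polynomial.eval₂_at_apply] at h1
    exact Subtype.coe_injective h1
  have hz' : (f.map (PadicInt.toZMod : ℤ_[p] →+* ZMod p)).IsRoot (PadicInt.toZMod z) := by
    rw [Polynomial.IsRoot, Polynomial.eval_map_apply, hz, map_zero]
  have hd := Polynomial.degree_eq_one_of_irreducible_of_root hirr hz'
  have hd2 : (f.map (PadicInt.toZMod : ℤ_[p] →+* ZMod p)).natDegree = 2 := by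
    rw [hmonic.natDegree_map, hdeg]
  rw [Polynomial.natDegree_eq_of_degree_eq_some hd] at hd2
  exact absurd hd2 (by norm_num)

/-- Continuous coordinates on `K` with respect to the basis `1, ω` over `ℚ_p`. -/
lemma IsUnramifiedQuadratic.exists_coords (hK : IsUnramifiedQuadratic p K ω) :
    ∃ re im : K →L[ℚ_[p]] ℚ_[p],
      (∀ z, algebraMap ℚ_[p] K (re z) + ω * algebraMap ℚ_[p] K (im z) = z) ∧
      ∀ x y, re (algebraMap ℚ_[p] K x + ω * algebraMap ℚ_[p] K y) = x ∧
        im (algebraMap ℚ_[p] K x + ω * algebraMap ℚ_[p] K y) = y := by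
  have hfin : FiniteDimensional ℚ_[p] K :=
    FiniteDimensional.of_finrank_pos (by rw [hK.finrank_eq_two]; norm_num)
  have hli : LinearIndependent ℚ_[p] ![(1 : K), ω] := by
    rw [LinearIndependent.pair_iff' one_ne_zero]
    intro x hx
    exact hK.algebraMap_ne x (by rw [← hx, Algebra.algebraMap_eq_smul_one])
  let b := basisOfLinearIndependentOfCardEqFinrank hli (by simp [hK.finrank_eq_two])
  have hb0 : b 0 = 1 := by simp [b]
  have hb1 : b 1 = ω := by simp [b]
  have hsum (x y : ℚ_[p]) :
      algebraMap ℚ_[p] K x + ω * algebraMap ℚ_[p] K y = x • b 0 + y • b 1 := by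
    rw [hb0, hb1, Algebra.smul_def, Algebra.smul_def, mul_one, mul_comm ω]
  refine ⟨(b.coord 0).toContinuousLinearMap, (b.coord 1).toContinuousLinearMap, fun z => ?_,
    fun x y => ?_⟩
  · rw [hsum]
    exact (Fin.sum_univ_two _).symm.trans (b.sum_repr z)
  · rw [hsum]
    simp

end Coordinates

/-! ### Quadratic polynomials on thick sets -/

section Thick

variable {p : ℕ} [hp : Fact p.Prime]

lemma mem_padicIdeal_iff {m : ℤ} {x : ℚ_[p]} : x ∈ padicIdeal p m ↔ ‖x‖ ≤ (p : ℝ) ^ (-m) := by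
  have hp0 : (p : ℚ_[p]) ≠ 0 := Nat.cast_ne_zero.2 hp.out.ne_zero
  have hp0' : (0 : ℝ) < p := Nat.cast_pos.2 hp.out.pos
  constructor
  · rintro ⟨z, rfl⟩
    rw [norm_mul, Padic.norm_p_zpow]
    exact mul_le_of_le_one_right (by positivity) z.norm_le_one
  · intro h
    refine ⟨⟨(p : ℚ_[p]) ^ (-m) * x, ?_⟩, ?_⟩
    · rw [norm_mul, Padic.norm_p_zpow, neg_neg]
      calc (p : ℝ) ^ m * ‖x‖ ≤ (p : ℝ) ^ m * (p : ℝ) ^ (-m) := by gcongr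
        _ = 1 := by rw [← zpow_add₀ hp0'.ne', add_neg_cancel, zpow_zero]
    · change (p : ℚ_[p]) ^ m * ((p : ℚ_[p]) ^ (-m) * x) = x
      rw [← mul_assoc, ← zpow_add₀ hp0, add_neg_cancel, zpow_zero, one_mul]

lemma IsThick.exists_norm {k : ℕ} {T : Set ℚ_[p]} (hT : IsThick p k T) (l : ℤ) :
    ∃ t ∈ T, (p : ℝ) ^ l < ‖t‖ ∧ ‖t‖ ≤ (p : ℝ) ^ (k + l) := by
  obtain ⟨t, ⟨h1, h2⟩, h3⟩ := hT l
  rw [mem_padicIdeal_iff, neg_neg] at h1 h2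
  exact ⟨t, h3, not_le.1 h2, h1⟩

lemma norm_add_sq_eq_max {e c t : ℚ_[p]} (h : ‖e * t‖ ≠ ‖c * t ^ 2‖) :
    ‖e * t + c * t ^ 2‖ = max ‖e * t‖ ‖c * t ^ 2‖ :=
  Padic.add_eq_max_of_ne h

/-- For coefficients not all zero there is a largest scale `L` at which all three monomials
`e t`, `c t ^ 2`, `f t` are bounded by `δ` on the ball of radius `p ^ L`. -/
lemma exists_greatest_scale {δ : ℝ} (hδ : 0 < δ) {E C F : ℝ} (hE : 0 ≤ E) (hC : 0 ≤ C) (hF : 0 ≤ F)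
    (h : ¬(E = 0 ∧ C = 0 ∧ F = 0)) :
    ∃ L : ℤ, (E * (p : ℝ) ^ L ≤ δ ∧ C * ((p : ℝ) ^ L) ^ 2 ≤ δ ∧ F * (p : ℝ) ^ L ≤ δ) ∧
      (δ < E * (p : ℝ) ^ (L + 1) ∨ δ < C * ((p : ℝ) ^ (L + 1)) ^ 2 ∨
        δ < F * (p : ℝ) ^ (L + 1)) := by
  have hp1 : (1 : ℝ) < p := Nat.one_lt_cast.2 hp.out.one_lt
  let P : ℤ → Prop := fun L =>
    E * (p : ℝ) ^ L ≤ δ ∧ C * ((p : ℝ) ^ L) ^ 2 ≤ δ ∧ F * (p : ℝ) ^ L ≤ δ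
  have hex : ∃ L, P L := by
    obtain ⟨n, hn⟩ := pow_unbounded_of_one_lt ((E + C + F) / δ) hp1
    rw [div_lt_iff₀ hδ] at hn
    have hpn : (1 : ℝ) ≤ (p : ℝ) ^ n := one_le_pow₀ hp1.le
    have hpos : (0 : ℝ) < (p : ℝ) ^ n := by linarith
    refine ⟨-(n : ℤ), ?_⟩
    simp only [P, zpow_neg, zpow_natCast, ← div_eq_mul_inv, inv_pow]
    rw [div_le_iff₀ hpos, div_le_iff₀ hpos, div_le_iff₀ (by positivity)]
    refine ⟨by nlinarith, ?_, by nlinarith⟩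
    nlinarith [mul_nonneg hδ.le (mul_nonneg hpos.le (sub_nonneg.2 hpn))]
  have hbdd : ∃ b : ℤ, ∀ L, P L → L ≤ b := by
    have key : ∀ D : ℝ, 0 < D → ∃ b : ℕ, ∀ L : ℤ, D * (p : ℝ) ^ L ≤ δ → L ≤ b := by
      intro D hD
      obtain ⟨n, hn⟩ := pow_unbounded_of_one_lt (δ / D) hp1
      refine ⟨n, fun L hL => ?_⟩
      have h1 : (p : ℝ) ^ L < (p : ℝ) ^ (n : ℤ) := by
        rw [zpow_natCast]
        refine lt_of_le_of_lt ?_ hn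
        rw [le_div_iff₀ hD]
        linarith
      exact ((zpow_lt_zpow_iff_right₀ hp1).1 h1).le
    by_cases h1 : E = 0
    · by_cases h2 : C = 0
      · have h3 : F ≠ 0 := fun h3 => h ⟨h1, h2, h3⟩
        obtain ⟨b, hb⟩ := key F (lt_of_le_of_ne hF h3.symm)
        exact ⟨b, fun L hL => hb L hL.2.2⟩
      · obtain ⟨b, hb⟩ := key C (lt_of_le_of_ne hC (Ne.symm h2))
        refine ⟨b, fun L hL => ?_⟩
        have := hb (L * 2) (by rw [zpow_mul]; exact_mod_cast hL.2.1)
        omega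
    · obtain ⟨b, hb⟩ := key E (lt_of_le_of_ne hE (Ne.symm h1))
      exact ⟨b, fun L hL => hb L hL.1⟩
  obtain ⟨L, hL, hmax⟩ := Int.exists_greatest_of_bdd hbdd hex
  refine ⟨L, hL, ?_⟩
  by_contra! hcon
  have := hmax (L + 1) hcon
  omega

/-- The quantitative form of thickness: at some `t ∈ T` the monomials `e t`, `c t ^ 2`, `f t` are
bounded by `δ`, while the pair `(e t + c t ^ 2, f t)` is bounded below by a constant that depends
on `k` and `δ` only. The terms `e t` and `c t ^ 2` can only cancel if `‖t‖ = ‖e‖ / ‖c‖`, so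
one of two points of `T` of different norms, at the critical scale, does the job. -/
lemma exists_lower_bound_of_isThick (p : ℕ) [hp : Fact p.Prime] (k : ℕ) {δ : ℝ} (hδ : 0 < δ) :
    ∃ η : ℝ, 0 < η ∧ ∀ T : Set ℚ_[p], IsThick p k T → ∀ e c f : ℚ_[p],
      ¬(e = 0 ∧ c = 0 ∧ f = 0) → ∃ t ∈ T, ‖e * t‖ ≤ δ ∧ ‖c * t ^ 2‖ ≤ δ ∧ ‖f * t‖ ≤ δ ∧
        η ≤ max ‖e * t + c * t ^ 2‖ ‖f * t‖ := by
  have hp1 : (1 : ℝ) < p := Nat.one_lt_cast.2 hp.out.one_lt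
  have hp0 : (0 : ℝ) < p := by linarith
  -- Both points of `T` used below have norm at least `ρ * p ^ (L + 1)`.
  set ρ : ℝ := (p : ℝ) ^ (-(2 * k + 1 : ℤ)) with hρ
  have hρ0 : 0 < ρ := by positivity
  have hρ1 : ρ ≤ 1 := zpow_le_one_of_nonpos₀ hp1.le (by omega)
  refine ⟨δ * ρ ^ 2, by positivity, fun T hT e c f hne => ?_⟩
  obtain ⟨L, ⟨hLe, hLc, hLf⟩, hL⟩ := exists_greatest_scale (p := p) hδ (norm_nonneg e)
    (norm_nonneg c) (norm_nonneg f) (by simpa using hne)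
  have hupper : ∀ t : ℚ_[p], ‖t‖ ≤ (p : ℝ) ^ L →
      ‖e * t‖ ≤ δ ∧ ‖c * t ^ 2‖ ≤ δ ∧ ‖f * t‖ ≤ δ := by
    intro t ht
    rw [norm_mul, norm_mul, norm_mul, norm_pow]
    exact ⟨le_trans (by gcongr) hLe, le_trans (by gcongr) hLc, le_trans (by gcongr) hLf⟩
  have hlower : ∀ t : ℚ_[p], (p : ℝ) ^ (L - 2 * k) ≤ ‖t‖ →
      δ * ρ ^ 2 ≤ max (max ‖e * t‖ ‖c * t ^ 2‖) ‖f * t‖ := by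
    intro t ht
    have ht' : (p : ℝ) ^ (L + 1) * ρ ≤ ‖t‖ := by
      rw [hρ, ← zpow_add₀ hp0.ne']
      convert ht using 2
      ring
    have hlin : ∀ x : ℚ_[p], δ < ‖x‖ * (p : ℝ) ^ (L + 1) → δ * ρ ^ 2 ≤ ‖x * t‖ := by
      intro x hx
      rw [norm_mul]
      calc δ * ρ ^ 2 ≤ δ * ρ := by
            gcongr
            nlinarith
        _ ≤ ‖x‖ * (p : ℝ) ^ (L + 1) * ρ := by gcongr
        _ ≤ ‖x‖ * ‖t‖ := by
            rw [mul_assoc]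
            gcongr
    rcases hL with h | h | h
    · exact le_max_of_le_left (le_max_of_le_left (hlin e h))
    · refine le_max_of_le_left (le_max_of_le_right ?_)
      rw [norm_mul, norm_pow]
      calc δ * ρ ^ 2 ≤ ‖c‖ * ((p : ℝ) ^ (L + 1)) ^ 2 * ρ ^ 2 := by gcongr
        _ = ‖c‖ * ((p : ℝ) ^ (L + 1) * ρ) ^ 2 := by ring
        _ ≤ ‖c‖ * ‖t‖ ^ 2 := by gcongr
    · exact le_max_of_le_right (hlin f h)
  obtain ⟨t₁, ht₁T, h₁l, h₁u⟩ := hT.exists_norm (L - k)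
  obtain ⟨t₂, ht₂T, h₂l, h₂u⟩ := hT.exists_norm (L - 2 * k)
  have h₁u' : ‖t₁‖ ≤ (p : ℝ) ^ L := by
    convert h₁u using 2
    ring
  have h₂u' : ‖t₂‖ ≤ (p : ℝ) ^ (L - k) := by
    convert h₂u using 2
    ring
  have h₁l' : (p : ℝ) ^ (L - 2 * k) ≤ ‖t₁‖ :=
    le_trans (zpow_le_zpow_right₀ hp1.le (by omega)) h₁l.le
  have h₂u'' : ‖t₂‖ ≤ (p : ℝ) ^ L := h₂u'.trans (zpow_le_zpow_right₀ hp1.le (by omega))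
  by_cases hn₁ : ‖e * t₁‖ ≠ ‖c * t₁ ^ 2‖
  · obtain ⟨a, b, d⟩ := hupper t₁ h₁u'
    exact ⟨t₁, ht₁T, a, b, d, by rw [norm_add_sq_eq_max hn₁]; exact hlower t₁ h₁l'⟩
  obtain ⟨a, b, d⟩ := hupper t₂ h₂u''
  refine ⟨t₂, ht₂T, a, b, d, ?_⟩
  by_cases hn₂ : ‖e * t₂‖ ≠ ‖c * t₂ ^ 2‖
  · rw [norm_add_sq_eq_max hn₂]
    exact hlower t₂ h₂l.le
  -- Equality at both points forces `e = c = 0`.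
  push Not at hn₁ hn₂
  have ht₂0 : 0 < ‖t₂‖ := lt_of_le_of_lt (by positivity) h₂l
  have ht₁₂ : ‖t₂‖ < ‖t₁‖ := lt_of_le_of_lt h₂u' h₁l
  rw [norm_mul, norm_mul, norm_pow, pow_two, ← mul_assoc] at hn₁ hn₂
  have e₁ := mul_right_cancel₀ (ht₂0.trans ht₁₂).ne' hn₁
  have e₂ := mul_right_cancel₀ ht₂0.ne' hn₂
  have hc : ‖c‖ = 0 := by
    have : ‖c‖ * (‖t₁‖ - ‖t₂‖) = 0 := by linarith
    rcases mul_eq_zero.1 this with h | h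
    · exact h
    · linarith
  have he : e = 0 := norm_eq_zero.1 (by rw [e₁, hc, zero_mul])
  have hc' : c = 0 := norm_eq_zero.1 hc
  have := hlower t₂ h₂l.le
  simpa [he, hc'] using this

end Thick

/-! ### Limits of sequences of coordinates -/

section Limits

variable {p : ℕ} [Fact p.Prime]

/-- If `c n → 0` while `c n * t n ^ 2` stays bounded, then `c n * t n → 0`. -/
lemma tendsto_mul_zero_of_norm_mul_sq_le {c t : ℕ → ℚ_[p]} {δ : ℝ}
    (hc : Tendsto c atTop (𝓝 0)) (h : ∀ᶠ n in atTop, ‖c n * t n ^ 2‖ ≤ δ) :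
    Tendsto (fun n => c n * t n) atTop (𝓝 0) := by
  have hlim : Tendsto (fun n => √(‖c n‖ * δ)) atTop (𝓝 0) := by
    simpa using (hc.norm.mul_const δ).sqrt
  refine squeeze_zero_norm' ?_ hlim
  filter_upwards [h] with n hn
  refine Real.le_sqrt_of_sq_le ?_
  calc ‖c n * t n‖ ^ 2 = ‖c n‖ * ‖c n * t n ^ 2‖ := by
        simp only [norm_mul, norm_pow]
        ring
    _ ≤ ‖c n‖ * δ := by gcongr

variable {K : Type*} [NormedField K] [NormedAlgebra ℚ_[p] K] {ω : K}

lemma tendsto_algebraMap {x : ℕ → ℚ_[p]} {x' : ℚ_[p]} (hx : Tendsto x atTop (𝓝 x')) :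
    Tendsto (fun n => algebraMap ℚ_[p] K (x n)) atTop (𝓝 (algebraMap ℚ_[p] K x')) :=
  ((continuous_algebraMap ℚ_[p] K).tendsto x').comp hx

lemma tendsto_re_im {re im : K →L[ℚ_[p]] ℚ_[p]}
    (hre : ∀ x y, re (algebraMap ℚ_[p] K x + ω * algebraMap ℚ_[p] K y) = x ∧
      im (algebraMap ℚ_[p] K x + ω * algebraMap ℚ_[p] K y) = y)
    {z : ℕ → K} {x : ℚ_[p]} (hz : Tendsto z atTop (𝓝 (algebraMap ℚ_[p] K x))) :
    Tendsto (fun n => re (z n)) atTop (𝓝 x) ∧ Tendsto (fun n => im (z n)) atTop (𝓝 0) := by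
  have h := hre x 0
  rw [map_zero, mul_zero, add_zero] at h
  have h1 := (re.continuous.tendsto _).comp hz
  have h2 := (im.continuous.tendsto _).comp hz
  rw [h.1] at h1
  rw [h.2] at h2
  exact ⟨h1, h2⟩

end Limits

/-! ### Sequences modulo `H` -/

section ModH

variable {p : ℕ} [Fact p.Prime] {K : Type*} [NormedField K] [NormedAlgebra ℚ_[p] K] {ω : K}

/-- The matrix `1 + ω Z` over `K` attached to a matrix `Z` over `ℚ_p`. -/
noncomputable def onePlus (ω : K) (Z : Matrix (Fin 2) (Fin 2) ℚ_[p]) : Matrix (Fin 2) (Fin 2) K :=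
  1 + ω • Z.map (algebraMap ℚ_[p] K)

lemma onePlus_eq (Z : Matrix (Fin 2) (Fin 2) ℚ_[p]) :
    onePlus ω Z = !![1 + ω * algebraMap ℚ_[p] K (Z 0 0), ω * algebraMap ℚ_[p] K (Z 0 1);
      ω * algebraMap ℚ_[p] K (Z 1 0), 1 + ω * algebraMap ℚ_[p] K (Z 1 1)] := by
  ext i j
  fin_cases i <;> fin_cases j <;> simp [onePlus]

/-- Every sequence tending to `1` in `PGL(2, K)` can be translated by `H` on the right into a
sequence of the form `1 + ω Z n` with `Z n` a matrix over `ℚ_p` tending to `0`. -/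
lemma exists_onePlus_of_tendsto (hK : IsUnramifiedQuadratic p K ω) {g : ℕ → PGL(2, K)}
    (hg : Tendsto g atTop (𝓝 1)) :
    ∃ (Z : ℕ → Matrix (Fin 2) (Fin 2) ℚ_[p]) (h : ℕ → PGL(2, K)),
      Tendsto Z atTop (𝓝 0) ∧ (∀ n, h n ∈ subgroupH p K) ∧
      ∀ᶠ n in atTop, (onePlus ω (Z n)).det ≠ 0 ∧ g n * h n = projMk (onePlus ω (Z n)) := by
  obtain ⟨re, im, hsum, hre⟩ := hK.exists_coords
  obtain ⟨A, hA, hgA⟩ := exists_tendsto_projMk_eq hg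
  let X : ℕ → Matrix (Fin 2) (Fin 2) ℚ_[p] := fun n => (A n).map re
  let Y : ℕ → Matrix (Fin 2) (Fin 2) ℚ_[p] := fun n => (A n).map im
  have hentry (i j) : Tendsto (fun n => A n i j) atTop
      (𝓝 (algebraMap ℚ_[p] K ((1 : Matrix (Fin 2) (Fin 2) ℚ_[p]) i j))) := by
    have := tendsto_pi_nhds.1 (tendsto_pi_nhds.1 hA i) j
    convert this using 2
    fin_cases i <;> fin_cases j <;> simp
  have hX : Tendsto X atTop (𝓝 1) :=
    tendsto_pi_nhds.2 fun i => tendsto_pi_nhds.2 fun j => (tendsto_re_im hre (hentry i j)).1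
  have hY : Tendsto Y atTop (𝓝 0) :=
    tendsto_pi_nhds.2 fun i => tendsto_pi_nhds.2 fun j => (tendsto_re_im hre (hentry i j)).2
  have hdet : Tendsto (fun n => (X n).det) atTop (𝓝 1) := by
    simpa [Function.comp_def] using (continuous_id.matrix_det.tendsto (1 : Matrix (Fin 2) (Fin 2) ℚ_[p])).comp hX
  have hadj : Tendsto (fun n => (X n).adjugate) atTop (𝓝 1) := by
    simpa [Function.comp_def] using (continuous_id.matrix_adjugate.tendsto (1 : Matrix (Fin 2) (Fin 2) ℚ_[p])).comp hX
  let B : ℕ → Matrix (Fin 2) (Fin 2) ℚ_[p] := fun n => ((X n).det)⁻¹ • (X n).adjugate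
  have hB : Tendsto B atTop (𝓝 1) := by
    simpa using (hdet.inv₀ one_ne_zero).smul hadj
  have hdetB : Tendsto (fun n => (B n).det) atTop (𝓝 1) := by
    simpa [Function.comp_def] using (continuous_id.matrix_det.tendsto (1 : Matrix (Fin 2) (Fin 2) ℚ_[p])).comp hB
  classical
  refine ⟨fun n => Y n * B n, fun n => if (B n).det ≠ 0 then
    projMk ((B n).map (algebraMap ℚ_[p] K)) else 1, ?_, fun n => ?_, ?_⟩
  · simpa using hY.mul hB
  · dsimp only
    split_ifs with h
    · exact projMk_map_mem_subgroupH K h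
    · exact one_mem _
  filter_upwards [hgA, hdet.eventually_ne one_ne_zero, hdetB.eventually_ne one_ne_zero]
    with n ⟨hAn, hgn, _⟩ hXn hBn
  have hXB : X n * B n = 1 := by
    simp only [B]
    rw [Matrix.mul_smul, Matrix.mul_adjugate, smul_smul, inv_mul_cancel₀ hXn, one_smul]
  have hAXY : A n = (X n).map (algebraMap ℚ_[p] K) + ω • (Y n).map (algebraMap ℚ_[p] K) := by
    ext i j
    simp [X, Y, hsum]
  have hprod : A n * (B n).map (algebraMap ℚ_[p] K) = onePlus ω (Y n * B n) := by
    rw [hAXY, add_mul, Matrix.smul_mul, ← Matrix.map_mul, ← Matrix.map_mul, hXB, onePlus,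
      Matrix.map_one _ (map_zero _) (map_one _)]
  have hBK : ((B n).map (algebraMap ℚ_[p] K)).det ≠ 0 := by
    have : ((B n).map (algebraMap ℚ_[p] K)).det = algebraMap ℚ_[p] K (B n).det :=
      (RingHom.map_det (algebraMap ℚ_[p] K) (B n)).symm
    rw [this]
    simpa using hBn
  rw [if_pos hBn, ← hprod, Matrix.det_mul, hgn, projMk_mul hAn hBK]
  exact ⟨mul_ne_zero hAn hBK, rfl⟩

/-- If `Z` is upper triangular with equal diagonal entries, then `1 + ω Z` is, up to a scalar,
unipotent with an upper right entry in `K = ℚ_p ω + ℚ_p`. -/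
lemma projMk_onePlus_mem (hK : IsUnramifiedQuadratic p K ω) {Z : Matrix (Fin 2) (Fin 2) ℚ_[p]}
    (hdet : (onePlus ω Z).det ≠ 0) (h10 : Z 1 0 = 0) (h11 : Z 1 1 = Z 0 0) :
    projMk (onePlus ω Z) ∈ setV p ω * (subgroupH p K : Set PGL(2, K)) := by
  obtain ⟨re, im, hsum, -⟩ := hK.exists_coords
  rw [onePlus_eq, h10, h11] at hdet ⊢
  rw [map_zero, mul_zero] at hdet ⊢
  set a := 1 + ω * algebraMap ℚ_[p] K (Z 0 0)
  set b := ω * algebraMap ℚ_[p] K (Z 0 1)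
  have ha : a ≠ 0 := by
    rintro ha
    simp [Matrix.det_fin_two, ha] at hdet
  refine ⟨unip (ω * algebraMap ℚ_[p] K (im (b / a))), ⟨_, rfl⟩,
    unip (algebraMap ℚ_[p] K (re (b / a))), unip_algebraMap_mem_subgroupH K _, ?_⟩
  dsimp only
  rw [← unip_add, add_comm, hsum, unip_eq_projMk, ← projMk_smul ha (by simp)]
  congr 1
  ext i j
  fin_cases i <;> fin_cases j <;> simp [mul_div_cancel₀ _ ha]

lemma unip_conj_onePlus {Z : Matrix (Fin 2) (Fin 2) ℚ_[p]} (hdet : (onePlus ω Z).det ≠ 0)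
    (t : ℚ_[p]) :
    unip (algebraMap ℚ_[p] K t) * projMk (onePlus ω Z) * unip (algebraMap ℚ_[p] K (-t)) =
      projMk (onePlus ω !![Z 0 0 + Z 1 0 * t, Z 0 1 + ((Z 1 1 - Z 0 0) * t + -Z 1 0 * t ^ 2);
        Z 1 0, Z 1 1 - Z 1 0 * t]) := by
  rw [unip_eq_projMk, unip_eq_projMk, ← projMk_mul (by simp) hdet,
    ← projMk_mul (by rw [Matrix.det_mul]; simpa using hdet) (by simp)]
  congr 1
  rw [onePlus_eq, onePlus_eq, Matrix.mul_fin_two, Matrix.mul_fin_two]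
  simp only [Matrix.of_apply, Matrix.cons_val', Matrix.cons_val_zero, Matrix.cons_val_one,
    Matrix.cons_val_fin_one, map_add, map_sub, map_mul, map_neg, map_pow]
  congr 1
  simp only [Matrix.vecCons_inj, and_true]
  refine ⟨⟨?_, ?_⟩, ?_, ?_⟩ <;> ring

/-- Translates `u_t g n h` with `h` in `H` accumulate at points of `𝒱` that are arbitrarily close to,
but different from, `1`. -/
theorem exists_tendsto_mem_setV (hK : IsUnramifiedQuadratic p K ω) {g : ℕ → PGL(2, K)}
    (hg : Tendsto g atTop (𝓝 1))
    (hgVH : ∀ n, g n ∉ setV p ω * (subgroupH p K : Set PGL(2, K)))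
    {k : ℕ} {T : ℕ → Set ℚ_[p]} (hT : ∀ n, IsThick p k (T n))
    {G₀ : Set PGL(2, K)} (hG₀ : G₀ ∈ 𝓝 (1 : PGL(2, K))) :
    ∃ (t : ℕ → ℚ_[p]) (h : ℕ → PGL(2, K)),
      (∀ n, t n ∈ T n) ∧ (∀ n, h n ∈ subgroupH p K) ∧
      ∃ φ : ℕ → ℕ, StrictMono φ ∧ ∃ γ ∈ setV p ω \ {1}, γ ∈ G₀ ∧
        Tendsto (fun n => unip (algebraMap ℚ_[p] K (t (φ n))) * g (φ n) * h (φ n))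
          atTop (𝓝 γ) := by
  have hω : ω ≠ 0 := fun h => hK.algebraMap_ne 0 (by rw [map_zero, h])
  obtain ⟨Z, h, hZ, hh, hgood⟩ := exists_onePlus_of_tendsto hK hg
  have hnhds : ∀ᶠ v : ℚ_[p] in 𝓝 0, unip (ω * algebraMap ℚ_[p] K v) ∈ G₀ := by
    have hc : Continuous fun v : ℚ_[p] => unip (ω * algebraMap ℚ_[p] K v) :=
      continuous_unip.comp (continuous_const.mul (continuous_algebraMap ℚ_[p] K))
    refine hc.continuousAt.eventually ?_
    simpa [unip_zero] using hG₀
  obtain ⟨δ, hδ, hδG⟩ := Metric.nhds_basis_closedBall.mem_iff.1 hnhds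
  obtain ⟨η, hη, hthick⟩ := exists_lower_bound_of_isThick p k hδ
  have hex : ∀ n, ∃ t ∈ T n, ¬(Z n 1 1 - Z n 0 0 = 0 ∧ -Z n 1 0 = 0) →
      ‖(Z n 1 1 - Z n 0 0) * t‖ ≤ δ ∧ ‖-Z n 1 0 * t ^ 2‖ ≤ δ ∧
        η ≤ ‖(Z n 1 1 - Z n 0 0) * t + -Z n 1 0 * t ^ 2‖ := by
    intro n
    by_cases hn : Z n 1 1 - Z n 0 0 = 0 ∧ -Z n 1 0 = 0
    · obtain ⟨t, ht, -⟩ := (hT n).exists_norm 0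
      exact ⟨t, ht, fun h => absurd hn h⟩
    · obtain ⟨t, ht, h1, h2, -, h3⟩ := hthick (T n) (hT n) (Z n 1 1 - Z n 0 0) (-Z n 1 0) 0
        (fun h => hn ⟨h.1, h.2.1⟩)
      rw [zero_mul, norm_zero, max_eq_left (norm_nonneg _)] at h3
      exact ⟨t, ht, fun _ => ⟨h1, h2, h3⟩⟩
  choose t htT ht using hex
  have hZ' (i j) : Tendsto (fun n => Z n i j) atTop (𝓝 0) :=
    tendsto_pi_nhds.1 (tendsto_pi_nhds.1 hZ i) j
  have hbound : ∀ᶠ n in atTop, ‖(Z n 1 1 - Z n 0 0) * t n‖ ≤ δ ∧ ‖-Z n 1 0 * t n ^ 2‖ ≤ δ ∧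
      η ≤ ‖(Z n 1 1 - Z n 0 0) * t n + -Z n 1 0 * t n ^ 2‖ := by
    filter_upwards [hgood] with n ⟨hdet, hgn⟩
    refine ht n fun hcon => hgVH n ?_
    have hmem := projMk_onePlus_mem hK hdet (neg_eq_zero.1 hcon.2) (sub_eq_zero.1 hcon.1)
    rw [← hgn] at hmem
    obtain ⟨v, hv, x, hx, hvx⟩ := hmem
    refine ⟨v, hv, x * (h n)⁻¹, mul_mem hx (inv_mem (hh n)), ?_⟩
    dsimp only at hvx ⊢
    rw [← mul_assoc, hvx, mul_inv_cancel_right]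
  have hct : Tendsto (fun n => Z n 1 0 * t n) atTop (𝓝 0) :=
    tendsto_mul_zero_of_norm_mul_sq_le (hZ' 1 0) (hbound.mono fun n hn => by simpa using hn.2.1)
  set q : ℕ → ℚ_[p] := fun n => (Z n 1 1 - Z n 0 0) * t n + -Z n 1 0 * t n ^ 2 with hq
  have hqball : ∀ᶠ n in atTop, q n ∈ Metric.closedBall (0 : ℚ_[p]) δ := by
    filter_upwards [hbound] with n hn
    rw [mem_closedBall_zero_iff]
    exact (Padic.nonarchimedean _ _).trans (max_le hn.1 hn.2.1)
  obtain ⟨v, hv, φ, hφ, hqv⟩ :=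
    (isCompact_closedBall (0 : ℚ_[p]) δ).tendsto_subseq' hqball.frequently
  have hv0 : v ≠ 0 := by
    have : η ≤ ‖v‖ :=
      ge_of_tendsto hqv.norm (hφ.tendsto_atTop.eventually (hbound.mono fun n hn => hn.2.2))
    exact norm_pos_iff.1 (hη.trans_le this)
  refine ⟨t, fun n => h n * unip (algebraMap ℚ_[p] K (-t n)), htT,
    fun n => mul_mem (hh n) (unip_algebraMap_mem_subgroupH K _), φ, hφ,
    unip (ω * algebraMap ℚ_[p] K v), ⟨⟨v, rfl⟩, unip_ne_one (mul_ne_zero hω (by simpa))⟩,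
    hδG hv, ?_⟩
  let W : ℕ → Matrix (Fin 2) (Fin 2) ℚ_[p] := fun n =>
    !![Z n 0 0 + Z n 1 0 * t n, Z n 0 1 + q n; Z n 1 0, Z n 1 1 - Z n 1 0 * t n]
  have hW : Tendsto (fun n => W (φ n)) atTop (𝓝 !![0, v; 0, 0]) := by
    have hs := hφ.tendsto_atTop
    refine tendsto_matrix_fin_two ?_ ?_ ((hZ' 1 0).comp hs) ?_
    · simpa using ((hZ' 0 0).comp hs).add (hct.comp hs)
    · simpa using ((hZ' 0 1).comp hs).add hqv
    · simpa using ((hZ' 1 1).comp hs).sub (hct.comp hs)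
  have hlim : onePlus ω !![0, v; 0, 0] = !![1, ω * algebraMap ℚ_[p] K v; 0, 1] := by
    rw [onePlus_eq]
    simp
  have hcont : Continuous fun Z : Matrix (Fin 2) (Fin 2) ℚ_[p] => onePlus ω Z :=
    continuous_const.add ((continuous_id.matrix_map (continuous_algebraMap ℚ_[p] K)).const_smul ω)
  have hmain : Tendsto (fun n => projMk (onePlus ω (W (φ n)))) atTop
      (𝓝 (unip (ω * algebraMap ℚ_[p] K v))) := by
    rw [unip_eq_projMk, ← hlim]
    have hdet : (onePlus ω !![0, v; 0, 0]).det ≠ 0 := by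
      rw [hlim]
      simp
    exact (continuousAt_projMk hdet).tendsto.comp ((hcont.tendsto _).comp hW)
  refine hmain.congr' ?_
  filter_upwards [hφ.tendsto_atTop.eventually hgood] with n ⟨hdet, hgn⟩
  have := unip_conj_onePlus hdet (t (φ n))
  rw [← hgn] at this
  rw [← mul_assoc, mul_assoc (unip _) (g _) (h _), this]

end ModH

/-! ### Sequences under left and right translation by `𝒰` -/

section DoubleCoset

variable {p : ℕ} [Fact p.Prime] {K : Type*} [NormedField K] [NormedAlgebra ℚ_[p] K] {ω : K}

/-- The matrix representing `diag((1 + κ) ^ 2, 1) * u_{ω v}` with `v = -w / (1 + κ) ^ 2`, divided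
by `1 + κ`: the general form of the limits of `u_t g u_s`. -/
noncomputable def limitMatrix (ω : K) (x : ℚ_[p] × ℚ_[p]) : Matrix (Fin 2) (Fin 2) K :=
  !![algebraMap ℚ_[p] K (1 + x.1), ω * algebraMap ℚ_[p] K (-x.2 / (1 + x.1));
    0, algebraMap ℚ_[p] K (1 + x.1)⁻¹]

lemma det_limitMatrix_ne_zero {x : ℚ_[p] × ℚ_[p]} (hx : 1 + x.1 ≠ 0) :
    (limitMatrix ω x).det ≠ 0 := by
  rw [limitMatrix, Matrix.det_fin_two_of, mul_zero, sub_zero, ← map_mul, mul_inv_cancel₀ hx,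
    map_one]
  exact one_ne_zero

lemma projMk_limitMatrix_mem {x : ℚ_[p] × ℚ_[p]} (hx : 1 + x.1 ≠ 0) :
    projMk (limitMatrix ω x) ∈ setA p K * setV p ω := by
  refine ⟨_, ⟨Units.mk0 ((1 + x.1) ^ 2) (pow_ne_zero 2 hx), rfl⟩, _,
    ⟨-x.2 / (1 + x.1) ^ 2, rfl⟩, ?_⟩
  have hx' : algebraMap ℚ_[p] K (1 + x.1) ≠ 0 :=
    (_root_.map_ne_zero _).2 hx
  dsimp only
  rw [diagOne_mul_unip, ← projMk_smul hx' (det_limitMatrix_ne_zero hx)]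
  congr 1
  rw [limitMatrix]
  ext i j
  fin_cases i <;> fin_cases j
  · simp [pow_two]
  · change algebraMap ℚ_[p] K ((1 + x.1) ^ 2) * (ω * algebraMap ℚ_[p] K (-x.2 / (1 + x.1) ^ 2)) =
      algebraMap ℚ_[p] K (1 + x.1) * (ω * algebraMap ℚ_[p] K (-x.2 / (1 + x.1)))
    rw [mul_left_comm, ← map_mul, mul_left_comm, ← map_mul, mul_div_cancel₀ _ (pow_ne_zero 2 hx),
      mul_div_cancel₀ _ hx]
  · simp
  · change (1 : K) = algebraMap ℚ_[p] K (1 + x.1) * algebraMap ℚ_[p] K (1 + x.1)⁻¹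
    rw [← map_mul, mul_inv_cancel₀ hx, map_one]

/-- The limit is nontrivial: `(1 + κ) ^ 2 = 1` has no small solution except `κ = 0`. -/
lemma eq_zero_of_projMk_limitMatrix (hω : ω ≠ 0) {x : ℚ_[p] × ℚ_[p]} (hx : 1 + x.1 ≠ 0)
    (h2 : ‖x.1‖ < ‖(2 : ℚ_[p])‖) (h : projMk (limitMatrix ω x) = 1) : x = 0 := by
  obtain ⟨h01, h00⟩ := entries_of_projMk_eq_one (det_limitMatrix_ne_zero hx) h
  simp only [limitMatrix, Matrix.of_apply, Matrix.cons_val', Matrix.cons_val_zero,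
    Matrix.cons_val_one, Matrix.cons_val_fin_one] at h01 h00
  have h1 : 1 + x.1 = (1 + x.1)⁻¹ := (algebraMap ℚ_[p] K).injective h00
  have h1' : x.1 * (x.1 + 2) = 0 := by
    have : (1 + x.1) * (1 + x.1) = 1 := by
      nth_rewrite 2 [h1]
      exact mul_inv_cancel₀ hx
    linear_combination this
  have hx1 : x.1 = 0 := by
    rcases mul_eq_zero.1 h1' with h | h
    · exact h
    · rw [eq_neg_of_add_eq_zero_left h, norm_neg] at h2
      exact absurd h2 (lt_irrefl _)
  have hx2 : x.2 = 0 := by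
    simpa [hω, hx1] using h01
  exact Prod.ext hx1 hx2

lemma continuousAt_limitMatrix : ContinuousAt (fun x : ℚ_[p] × ℚ_[p] => limitMatrix ω x) 0 := by
  have h1 : ContinuousAt (fun x : ℚ_[p] × ℚ_[p] => 1 + x.1) 0 := by
    fun_prop
  have h0 : (1 : ℚ_[p]) + (0 : ℚ_[p] × ℚ_[p]).1 ≠ 0 := by simp
  have ha := (continuous_algebraMap ℚ_[p] K).continuousAt.comp h1
  have hb := (continuous_algebraMap ℚ_[p] K).continuousAt.comp
    ((continuous_snd.neg.continuousAt (x := (0 : ℚ_[p] × ℚ_[p]))).div h1 h0)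
  have hd := (continuous_algebraMap ℚ_[p] K).continuousAt.comp (h1.inv₀ h0)
  exact tendsto_matrix_fin_two ha (hb.const_mul ω) tendsto_const_nhds hd

/-- A sequence with vanishing coefficients but nonvanishing values must escape to infinity. -/
lemma tendsto_norm_atTop_of_le {e c f t : ℕ → ℚ_[p]} {η : ℝ} (hη : 0 < η)
    (he : Tendsto e atTop (𝓝 0)) (hc : Tendsto c atTop (𝓝 0)) (hf : Tendsto f atTop (𝓝 0))
    (h : ∀ᶠ n in atTop, η ≤ max ‖e n * t n + c n * t n ^ 2‖ ‖f n * t n‖) :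
    Tendsto (fun n => ‖t n‖) atTop atTop := by
  refine tendsto_atTop.2 fun R => ?_
  have hlim : Tendsto (fun n => ‖e n‖ * |R| + ‖c n‖ * |R| ^ 2 + ‖f n‖ * |R|) atTop (𝓝 0) := by
    have := ((he.norm.mul_const |R|).add (hc.norm.mul_const (|R| ^ 2))).add
      (hf.norm.mul_const |R|)
    rwa [norm_zero, zero_mul, zero_mul, zero_add, zero_add] at this
  filter_upwards [h, hlim.eventually_lt_const hη] with n hn hlt
  by_contra! hR
  have hR' : ‖t n‖ ≤ |R| := hR.le.trans (le_abs_self R)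
  refine absurd (hn.trans (max_le ?_ ?_)) (not_le.2 hlt)
  · refine (norm_add_le _ _).trans ?_
    rw [norm_mul, norm_mul, norm_pow]
    have h1 : ‖e n‖ * ‖t n‖ ≤ ‖e n‖ * |R| := by gcongr
    have h2 : ‖c n‖ * ‖t n‖ ^ 2 ≤ ‖c n‖ * |R| ^ 2 := by gcongr
    have h3 : 0 ≤ ‖f n‖ * |R| := by positivity
    linarith
  · rw [norm_mul]
    have h1 : ‖f n‖ * ‖t n‖ ≤ ‖f n‖ * |R| := by gcongr
    have h2 : 0 ≤ ‖e n‖ * |R| := by positivity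
    have h3 : 0 ≤ ‖c n‖ * |R| ^ 2 := by positivity
    linarith

lemma tendsto_cocompact_iff_norm {t : ℕ → ℚ_[p]} :
    Tendsto t atTop (cocompact ℚ_[p]) ↔ Tendsto (fun n => ‖t n‖) atTop atTop := by
  rw [← Metric.cobounded_eq_cocompact, tendsto_norm_atTop_iff_cobounded]

/-- With `a = a₀ + ω a₁` and so on, and `s = -(b₀ + t) / (a₀ + t c₀)`, the upper right entry of
`u_t g u_s` lies in `ℚ_p ω`. -/
lemma unip_mul_projMk_mul_unip {a₀ a₁ b₀ b₁ t D : ℚ_[p]} {c : K} {c₀ c₁ : ℚ_[p]}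
    (hc : c = algebraMap ℚ_[p] K c₀ + ω * algebraMap ℚ_[p] K c₁) (hD : D = a₀ + t * c₀)
    (hD0 : D ≠ 0)
    (hdet : (!![algebraMap ℚ_[p] K a₀ + ω * algebraMap ℚ_[p] K a₁,
      algebraMap ℚ_[p] K b₀ + ω * algebraMap ℚ_[p] K b₁; c, 1]).det ≠ 0) :
    unip (algebraMap ℚ_[p] K t) * projMk !![algebraMap ℚ_[p] K a₀ + ω * algebraMap ℚ_[p] K a₁,
        algebraMap ℚ_[p] K b₀ + ω * algebraMap ℚ_[p] K b₁; c, 1] *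
      unip (algebraMap ℚ_[p] K (-(b₀ + t) / D)) =
    projMk !![algebraMap ℚ_[p] K D + ω * algebraMap ℚ_[p] K (a₁ + c₁ * t),
      ω * algebraMap ℚ_[p] K (b₁ - (b₀ * (a₁ + c₁ * t) + (a₁ * t + c₁ * t ^ 2)) / D);
      c, 1 - (c * algebraMap ℚ_[p] K b₀ +
        (algebraMap ℚ_[p] K (c₀ * t) + ω * algebraMap ℚ_[p] K (c₁ * t))) *
          algebraMap ℚ_[p] K D⁻¹] := by
  rw [unip_eq_projMk, unip_eq_projMk, ← projMk_mul (by simp) hdet,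
    ← projMk_mul (by rw [Matrix.det_mul]; simpa using hdet) (by simp)]
  congr 1
  have hD' : algebraMap ℚ_[p] K D = algebraMap ℚ_[p] K a₀ +
      algebraMap ℚ_[p] K t * algebraMap ℚ_[p] K c₀ := by rw [hD, map_add, map_mul]
  have hDK : algebraMap ℚ_[p] K D ≠ 0 := by simpa using hD0
  rw [Matrix.mul_fin_two, Matrix.mul_fin_two]
  simp only [map_add, map_sub, map_mul, map_neg, map_div₀, map_inv₀, map_pow]
  rw [hc]
  congr 1
  simp only [Matrix.vecCons_inj, and_true]
  refine ⟨⟨?_, ?_⟩, ?_, ?_⟩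
  · rw [hD']
    ring
  · field_simp
    rw [hD']
    ring
  · ring
  · field_simp
    ring

/-- Translates `u_t g n u_s` with `t, s → ∞` accumulate at points of `𝒜 𝒱` that are arbitrarily close
to, but different from, `1`. -/
theorem exists_tendsto_mem_setA_mul_setV (hK : IsUnramifiedQuadratic p K ω) {g : ℕ → PGL(2, K)}
    (hg : Tendsto g atTop (𝓝 1)) (hgAN : ∀ n, g n ∉ setA p K * setN K)
    {k : ℕ} {T : ℕ → Set ℚ_[p]} (hT : ∀ n, IsThick p k (T n))
    {G₀ : Set PGL(2, K)} (hG₀ : G₀ ∈ 𝓝 (1 : PGL(2, K))) :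
    ∃ t s : ℕ → ℚ_[p],
      (∀ n, t n ∈ T n) ∧
      Tendsto t atTop (cocompact ℚ_[p]) ∧ Tendsto s atTop (cocompact ℚ_[p]) ∧
      ∃ φ : ℕ → ℕ, StrictMono φ ∧ ∃ γ ∈ (setA p K * setV p ω) \ {1}, γ ∈ G₀ ∧
        Tendsto (fun n => unip (algebraMap ℚ_[p] K (t (φ n))) * g (φ n) *
            unip (algebraMap ℚ_[p] K (s (φ n))))
          atTop (𝓝 γ) := by
  have hω : ω ≠ 0 := fun h => hK.algebraMap_ne 0 (by rw [map_zero, h])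
  obtain ⟨re, im, hsum, hre⟩ := hK.exists_coords
  obtain ⟨A, hA, hgA⟩ := exists_tendsto_projMk_eq hg
  have hentry (i j) : Tendsto (fun n => A n i j) atTop
      (𝓝 (algebraMap ℚ_[p] K ((1 : Matrix (Fin 2) (Fin 2) ℚ_[p]) i j))) := by
    have := tendsto_pi_nhds.1 (tendsto_pi_nhds.1 hA i) j
    convert this using 2
    fin_cases i <;> fin_cases j <;> simp
  set a₀ : ℕ → ℚ_[p] := fun n => re (A n 0 0)
  set a₁ : ℕ → ℚ_[p] := fun n => im (A n 0 0)
  set b₀ : ℕ → ℚ_[p] := fun n => re (A n 0 1)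
  set b₁ : ℕ → ℚ_[p] := fun n => im (A n 0 1)
  set c₀ : ℕ → ℚ_[p] := fun n => re (A n 1 0)
  set c₁ : ℕ → ℚ_[p] := fun n => im (A n 1 0)
  have ha₀ : Tendsto a₀ atTop (𝓝 1) := by simpa using (tendsto_re_im hre (hentry 0 0)).1
  have ha₁ : Tendsto a₁ atTop (𝓝 0) := (tendsto_re_im hre (hentry 0 0)).2
  have hb₀ : Tendsto b₀ atTop (𝓝 0) := by simpa using (tendsto_re_im hre (hentry 0 1)).1
  have hb₁ : Tendsto b₁ atTop (𝓝 0) := (tendsto_re_im hre (hentry 0 1)).2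
  have hc₀ : Tendsto c₀ atTop (𝓝 0) := by simpa using (tendsto_re_im hre (hentry 1 0)).1
  have hc₁ : Tendsto c₁ atTop (𝓝 0) := (tendsto_re_im hre (hentry 1 0)).2
  have hc : Tendsto (fun n => A n 1 0) atTop (𝓝 0) := by simpa using hentry 1 0
  -- The limit is nontrivial and lies in `G₀` once `δ` is small.
  have hnhds : ∀ᶠ x : ℚ_[p] × ℚ_[p] in 𝓝 0,
      projMk (limitMatrix ω x) ∈ G₀ ∧ ‖x.1‖ < ‖(2 : ℚ_[p])‖ ∧ ‖x.1‖ < 1 := by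
    have hone : limitMatrix ω (0 : ℚ_[p] × ℚ_[p]) = 1 := by
      rw [Matrix.one_fin_two]
      simp [limitMatrix]
    have hcont : ContinuousAt (fun x : ℚ_[p] × ℚ_[p] => projMk (limitMatrix ω x)) 0 :=
      ContinuousAt.comp (g := projMk)
        (continuousAt_projMk (det_limitMatrix_ne_zero (by simp))) continuousAt_limitMatrix
    have hnorm : Tendsto (fun x : ℚ_[p] × ℚ_[p] => ‖x.1‖) (𝓝 0) (𝓝 0) := by
      simpa using (continuous_fst.norm.tendsto (0 : ℚ_[p] × ℚ_[p]))
    refine (hcont.eventually ?_).and ((hnorm.eventually_lt_const (norm_pos_iff.2 two_ne_zero)).and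
      (hnorm.eventually_lt_const one_pos))
    beta_reduce
    rw [hone, projMk_one]
    exact hG₀
  obtain ⟨δ, hδ, hδG⟩ := Metric.nhds_basis_closedBall.mem_iff.1 hnhds
  have hδ1 : ∀ x : ℚ_[p], ‖x‖ ≤ δ → ‖x‖ < 1 := by
    intro x hx
    exact (hδG (show (x, (0 : ℚ_[p])) ∈ Metric.closedBall 0 δ by
      simpa [Prod.norm_def, hδ.le] using hx)).2.2
  obtain ⟨η, hη, hthick⟩ := exists_lower_bound_of_isThick p k hδ
  have hex : ∀ n, ∃ t ∈ T n, ¬(a₁ n = 0 ∧ c₁ n = 0 ∧ c₀ n = 0) →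
      ‖a₁ n * t‖ ≤ δ ∧ ‖c₁ n * t ^ 2‖ ≤ δ ∧ ‖c₀ n * t‖ ≤ δ ∧
        η ≤ max ‖a₁ n * t + c₁ n * t ^ 2‖ ‖c₀ n * t‖ := by
    intro n
    by_cases hn : a₁ n = 0 ∧ c₁ n = 0 ∧ c₀ n = 0
    · obtain ⟨t, ht, -⟩ := (hT n).exists_norm 0
      exact ⟨t, ht, fun h => absurd hn h⟩
    · obtain ⟨t, ht, h⟩ := hthick (T n) (hT n) _ _ _ hn
      exact ⟨t, ht, fun _ => h⟩
  choose t htT ht using hex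
  have hgood : ∀ᶠ n in atTop, (A n).det ≠ 0 ∧ g n = projMk (A n) ∧
      A n = !![algebraMap ℚ_[p] K (a₀ n) + ω * algebraMap ℚ_[p] K (a₁ n),
        algebraMap ℚ_[p] K (b₀ n) + ω * algebraMap ℚ_[p] K (b₁ n); A n 1 0, 1] := by
    filter_upwards [hgA] with n ⟨hdet, hgn, h11⟩
    refine ⟨hdet, hgn, ?_⟩
    rw [hsum, hsum, ← h11]
    exact Matrix.eta_fin_two _
  have hbound : ∀ᶠ n in atTop, ‖a₁ n * t n‖ ≤ δ ∧ ‖c₁ n * t n ^ 2‖ ≤ δ ∧ ‖c₀ n * t n‖ ≤ δ ∧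
      η ≤ max ‖a₁ n * t n + c₁ n * t n ^ 2‖ ‖c₀ n * t n‖ := by
    filter_upwards [hgood] with n ⟨hdet, hgn, hAn⟩
    refine ht n fun ⟨h1, h2, h3⟩ => hgAN n ?_
    have hc0 : A n 1 0 = 0 := by
      rw [← hsum (A n 1 0)]
      change algebraMap ℚ_[p] K (c₀ n) + ω * algebraMap ℚ_[p] K (c₁ n) = 0
      rw [h2, h3, map_zero, mul_zero, add_zero]
    rw [hc0, h1, map_zero, mul_zero, add_zero] at hAn
    rw [hAn] at hgn hdet
    have ha : algebraMap ℚ_[p] K (a₀ n) ≠ 0 := by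
      intro h
      simp [Matrix.det_fin_two, h] at hdet
    have ha' : a₀ n ≠ 0 := fun h => ha (by rw [h, map_zero])
    refine ⟨_, ⟨Units.mk0 (a₀ n) ha', rfl⟩, _, ⟨A n 0 1 / algebraMap ℚ_[p] K (a₀ n), rfl⟩, ?_⟩
    dsimp only
    rw [diagOne_mul_unip, hgn, hsum]
    congr 1
    simp [mul_div_cancel₀ _ ha]
  have hc₁t : Tendsto (fun n => c₁ n * t n) atTop (𝓝 0) :=
    tendsto_mul_zero_of_norm_mul_sq_le hc₁ (hbound.mono fun n hn => hn.2.1)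
  have htinf : Tendsto (fun n => ‖t n‖) atTop atTop :=
    tendsto_norm_atTop_of_le hη ha₁ hc₁ hc₀ (hbound.mono fun n hn => hn.2.2.2)
  let D : ℕ → ℚ_[p] := fun n => a₀ n + t n * c₀ n
  have hDnorm : ∀ᶠ n in atTop, D n ≠ 0 ∧ ‖D n‖ ≤ 3 := by
    have h1 : Tendsto (fun n => ‖a₀ n - 1‖) atTop (𝓝 0) := by
      simpa using (ha₀.sub_const 1).norm
    filter_upwards [hbound, h1.eventually_lt_const one_pos] with n hn hn1
    have h2 : ‖(a₀ n - 1) + c₀ n * t n‖ < 1 :=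
      (Padic.nonarchimedean _ _).trans_lt (max_lt hn1 (hδ1 _ hn.2.2.1))
    have h3 : D n = 1 + ((a₀ n - 1) + c₀ n * t n) := by
      simp only [D]
      ring
    constructor
    · intro h0
      rw [h3, add_comm] at h0
      rw [eq_neg_of_add_eq_zero_left h0, norm_neg, norm_one] at h2
      exact lt_irrefl _ h2
    · rw [h3]
      refine (norm_add_le _ _).trans ?_
      rw [norm_one]
      linarith
  let s : ℕ → ℚ_[p] := fun n => -(b₀ n + t n) / D n
  have hsinf : Tendsto (fun n => ‖s n‖) atTop atTop := by
    have hlow : Tendsto (fun n => (‖t n‖ + -1) / 3) atTop atTop :=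
      (tendsto_atTop_add_const_right _ (-1) htinf).atTop_div_const (by norm_num)
    refine tendsto_atTop_mono' _ ?_ hlow
    have hb : Tendsto (fun n => ‖b₀ n‖) atTop (𝓝 0) := by simpa using hb₀.norm
    filter_upwards [hDnorm, hb.eventually_lt_const one_pos] with n ⟨hD0, hD3⟩ hbn
    have hDpos : 0 < ‖D n‖ := norm_pos_iff.2 hD0
    have h1 : ‖t n‖ + -1 ≤ ‖b₀ n + t n‖ := by
      have := norm_sub_le (b₀ n + t n) (b₀ n)
      rw [add_sub_cancel_left] at this
      linarith
    simp only [s, norm_div, norm_neg]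
    calc (‖t n‖ + -1) / 3 ≤ ‖b₀ n + t n‖ / 3 := by gcongr
      _ ≤ ‖b₀ n + t n‖ / ‖D n‖ := by gcongr
  let x : ℕ → ℚ_[p] × ℚ_[p] := fun n => (c₀ n * t n, a₁ n * t n + c₁ n * t n ^ 2)
  have hxball : ∀ᶠ n in atTop, x n ∈ Metric.closedBall (0 : ℚ_[p] × ℚ_[p]) δ := by
    filter_upwards [hbound] with n hn
    rw [mem_closedBall_zero_iff, Prod.norm_def]
    exact max_le hn.2.2.1 ((Padic.nonarchimedean _ _).trans (max_le hn.1 hn.2.1))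
  obtain ⟨y, hy, φ, hφ, hxy⟩ :=
    (isCompact_closedBall (0 : ℚ_[p] × ℚ_[p]) δ).tendsto_subseq' hxball.frequently
  have hs := hφ.tendsto_atTop
  have hy0 : y ≠ 0 := by
    have : η ≤ ‖y‖ := by
      refine ge_of_tendsto hxy.norm ?_
      filter_upwards [hs.eventually hbound] with n hn
      rw [Function.comp_apply, Prod.norm_def, max_comm]
      exact hn.2.2.2
    exact norm_pos_iff.1 (hη.trans_le this)
  obtain ⟨hyG, hy2, hy1⟩ := hδG hy
  have hy1' : 1 + y.1 ≠ 0 := by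
    intro h
    rw [eq_neg_of_add_eq_zero_right h, norm_neg, norm_one] at hy1
    exact lt_irrefl _ hy1
  refine ⟨t, s, htT, tendsto_cocompact_iff_norm.2 htinf, tendsto_cocompact_iff_norm.2 hsinf, φ, hφ,
    projMk (limitMatrix ω y), ⟨projMk_limitMatrix_mem hy1', fun h =>
      hy0 (eq_zero_of_projMk_limitMatrix hω hy1' hy2 h)⟩, hyG, ?_⟩
  have hκ : Tendsto (fun n => c₀ (φ n) * t (φ n)) atTop (𝓝 y.1) :=
    (continuous_fst.tendsto y).comp hxy
  have hw : Tendsto (fun n => a₁ (φ n) * t (φ n) + c₁ (φ n) * t (φ n) ^ 2) atTop (𝓝 y.2) :=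
    (continuous_snd.tendsto y).comp hxy
  have hD : Tendsto (fun n => D (φ n)) atTop (𝓝 (1 + y.1)) := by
    simpa [D, mul_comm] using (ha₀.comp hs).add hκ
  have hsl : Tendsto (fun n => a₁ (φ n) + c₁ (φ n) * t (φ n)) atTop (𝓝 0) := by
    simpa using (ha₁.comp hs).add (hc₁t.comp hs)
  have hct : Tendsto (fun n => algebraMap ℚ_[p] K (c₀ (φ n) * t (φ n)) +
      ω * algebraMap ℚ_[p] K (c₁ (φ n) * t (φ n))) atTop (𝓝 (algebraMap ℚ_[p] K y.1)) := by
    simpa using (tendsto_algebraMap hκ).add ((tendsto_algebraMap (hc₁t.comp hs)).const_mul ω)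
  have hDinv := tendsto_algebraMap (K := K) (hD.inv₀ hy1')
  have h00 := (tendsto_algebraMap (K := K) hD).add ((tendsto_algebraMap hsl).const_mul ω)
  have h01 := (tendsto_algebraMap (K := K)
    ((hb₁.comp hs).sub ((((hb₀.comp hs).mul hsl).add hw).div hD hy1'))).const_mul ω
  have h11 := tendsto_const_nhds (x := (1 : K)).sub
    ((((hc.comp hs).mul (tendsto_algebraMap (K := K) (hb₀.comp hs))).add hct).mul hDinv)
  have hlim := tendsto_matrix_fin_two h00 h01 (hc.comp hs) h11
  have hvalue : limitMatrix ω y = !![algebraMap ℚ_[p] K (1 + y.1) + ω * algebraMap ℚ_[p] K 0,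
      ω * algebraMap ℚ_[p] K (0 - (0 * 0 + y.2) / (1 + y.1));
      0, 1 - (0 * algebraMap ℚ_[p] K 0 + algebraMap ℚ_[p] K y.1) *
        algebraMap ℚ_[p] K (1 + y.1)⁻¹] := by
    have h1 : 1 - algebraMap ℚ_[p] K y.1 * algebraMap ℚ_[p] K (1 + y.1)⁻¹ =
        algebraMap ℚ_[p] K (1 + y.1)⁻¹ := by
      rw [← map_mul, ← map_one (algebraMap ℚ_[p] K), ← map_sub]
      congr 1
      field_simp
      ring
    rw [limitMatrix, zero_mul, zero_mul, zero_add, zero_add, h1, map_zero, mul_zero, add_zero,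
      zero_sub, neg_div]
  rw [← hvalue] at hlim
  refine ((continuousAt_projMk (det_limitMatrix_ne_zero hy1')).tendsto.comp hlim).congr' ?_
  filter_upwards [hs.eventually hgood, hs.eventually hDnorm] with n ⟨hdet, hgn, hAn⟩ ⟨hD0, _⟩
  rw [hAn] at hdet
  have key := unip_mul_projMk_mul_unip (hsum (A (φ n) 1 0)).symm rfl hD0 hdet
  rw [← hAn, ← hgn] at key
  exact key.symm

end DoubleCoset

theorem theorem3p4 (p : ℕ) [Fact p.Prime] (hp : p ≠ 2)
    {K : Type*} [NormedField K] [NormedAlgebra ℚ_[p] K] (ω : K)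
    (hK : IsUnramifiedQuadratic p K ω)
    (g g' : ℕ → PGL(2, K))
    (hg : Tendsto g atTop (𝓝 1))
    (hgVH : ∀ n, g n ∉ setV p ω * (subgroupH p K : Set PGL(2, K)))
    (hg' : Tendsto g' atTop (𝓝 1))
    (hgAN : ∀ n, g' n ∉ setA p K * setN K)
    (k : ℕ) (T : ℕ → Set ℚ_[p]) (hT : ∀ n, IsThick p k (T n))
    (G₀ : Set PGL(2, K)) (hG₀ : G₀ ∈ 𝓝 (1 : PGL(2, K))) :
    (∃ (t : ℕ → ℚ_[p]) (h : ℕ → PGL(2, K)),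
      (∀ n, t n ∈ T n) ∧ (∀ n, h n ∈ subgroupH p K) ∧
      ∃ φ : ℕ → ℕ, StrictMono φ ∧ ∃ γ ∈ setV p ω \ {1}, γ ∈ G₀ ∧
        Tendsto (fun n => unip (algebraMap ℚ_[p] K (t (φ n))) * g (φ n) * h (φ n))
          atTop (𝓝 γ)) ∧
    (∃ t s : ℕ → ℚ_[p],
      (∀ n, t n ∈ T n) ∧
      Tendsto t atTop (cocompact ℚ_[p]) ∧ Tendsto s atTop (cocompact ℚ_[p]) ∧
      ∃ φ : ℕ → ℕ, StrictMono φ ∧ ∃ γ ∈ (setA p K * setV p ω) \ {1}, γ ∈ G₀ ∧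
        Tendsto (fun n => unip (algebraMap ℚ_[p] K (t (φ n))) * g' (φ n) *
            unip (algebraMap ℚ_[p] K (s (φ n))))
          atTop (𝓝 γ)) :=
  ⟨exists_tendsto_mem_setV hK hg hgVH hT hG₀, exists_tendsto_mem_setA_mul_setV hK hg' hgAN hT hG₀⟩
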